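/- Conventions. For a morphism of schemes $f : X \to S$, let $\mathrm{Rel}(f) \subset S$ (resp. $\mathrm{QRel}(f) \subset S$) be the set of points $f(x)$, where $x$ runs over the points of $X$ such that the residue field extension $\kappa(f(x)) \subset \kappa(x)$ is trivial (resp. purely inseparable). A scheme $S$ is a *Poonen scheme* if for every nonempty open subscheme $U \subset S$ and every dominant morphism of finite presentation $f : X \to U$, one has $\mathrm{QRel}(f) \neq \emptyset$. A commutative ring $A$ is a *Poonen ring* if $\mathrm{Spec}(A)$ is a Poonen scheme. **Theorem.** Let $A$ be a local integral domain of Krull dimension $\geq 2$, with maximal ideal $\mathfrak{m}$. Assume that for every nonzero $x \in \mathfrak{m}$, the space $\mathrm{Spec}(A/xA)$ has only finitely many irreducible components, and that each of them has codimension $1$ in $\mathrm{Spec}(A)$. Then: (P1) for every nonconstant polynomial $F \in A[Y]$, with structure morphism $f_F : \mathrm{Spec}(A[Y]/(F)) \to \mathrm{Spec}(A)$, the set $\mathrm{Rel}(f_F)$ is dense in $\mathrm{Spec}(A)$. Consequently, $A$ is a Poonen ring. -/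

import Mathlib

universe u

open CategoryTheory AlgebraicGeometry Polynomial TopologicalSpace

noncomputable section

/-- The points `x` of `X` whose residue field is a trivial extension of the residue field of the
image `f x`. -/
def relTilde {X S : Scheme.{u}} (f : X ⟶ S) : Set X :=
  {x | Function.Bijective (f.residueFieldMap x).hom}

/-- The points `x` of `X` whose residue field is a purely inseparable (in particular algebraic)
extension of the residue field of the image `f x`. -/
def qRelTilde {X S : Scheme.{u}} (f : X ⟶ S) : Set X :=
  {x | (f.residueFieldMap x).hom.IsPurelyInseparable}

/-- `Rel(f)`: the points of `S` that lift to `X`. -/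
def rel {X S : Scheme.{u}} (f : X ⟶ S) : Set S :=
  f '' relTilde f

/-- `QRel(f)`: the points of `S` that quasi-lift to `X`. -/
def qRel {X S : Scheme.{u}} (f : X ⟶ S) : Set S :=
  f '' qRelTilde f

/-- A scheme `S` is a Poonen scheme if for every nonempty open `U` of `S`, every dominant morphism
of finite presentation `f : X ⟶ U` has a point `x` whose residue field is purely inseparable over
that of `f x`. (Finite presentation: locally of finite presentation, quasi-compact and
quasi-separated.) -/
def IsPoonenScheme (S : Scheme.{u}) : Prop :=
  ∀ (U : S.Opens), (U : Set S).Nonempty → ∀ (X : Scheme.{u}) (f : X ⟶ (U : Scheme.{u})),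
    LocallyOfFinitePresentation f → QuasiCompact f → QuasiSeparated f → IsDominant f →
      (qRel f).Nonempty

/-- A ring is a Poonen ring if its spectrum is a Poonen scheme. -/
def IsPoonenRing (A : Type u) [CommRing A] : Prop :=
  IsPoonenScheme (Spec (CommRingCat.of A))

/-- The structure morphism of `X_F = Spec (A[Y] / (F))` over `S = Spec A`. -/
def hypersurfaceHom (A : Type u) [CommRing A] (F : A[X]) :
    Spec (CommRingCat.of (A[X] ⧸ Ideal.span {F})) ⟶ Spec (CommRingCat.of A) :=
  Spec.map (CommRingCat.ofHom (algebraMap A (A[X] ⧸ Ideal.span {F})))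

/-- Condition (P1): for every nonconstant `F` in `A[Y]`, the set `Rel(X_F / S)` is dense in `S`. -/
def ConditionP1 (A : Type u) [CommRing A] : Prop :=
  ∀ F : A[X], 0 < F.natDegree → Dense (rel (hypersurfaceHom A F))

/-- `Spec (A / xA)` has finitely many irreducible components, and each of them, viewed as a closed
irreducible subset `Z` of `Spec A`, has codimension one in `Spec A`. The codimension of `Z` is the
supremum of the lengths of chains of irreducible closed subsets starting at `Z` and going up. -/
def HasFinitelyManyComponentsOfCodimOne (A : Type u) [CommRing A] (x : A) : Prop :=
  (irreducibleComponents (PrimeSpectrum (A ⧸ Ideal.span {x}))).Finite ∧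
    ∀ T ∈ irreducibleComponents (PrimeSpectrum (A ⧸ Ideal.span {x})),
      ∃ Z : IrreducibleCloseds (PrimeSpectrum A),
        (Z : Set (PrimeSpectrum A)) =
            PrimeSpectrum.comap (Ideal.Quotient.mk (Ideal.span {x})) '' T ∧
          Order.coheight Z = 1

end

/-! Everything rests on `exists_prime_exists_root`. Write F = a₀ + Y·F₁ of degree n, with leading
coefficient a. If a₀ ≠ 0, choose a nonzero multiple D of a₀·a·g in the maximal ideal, and by prime
avoidance an element v of that ideal outside the finitely many height-one minimal primes over D.
Substituting Y = a₀D/v gives vⁿF(Y) = a₀·w with w = vⁿ + D·N. A minimal prime q over w has height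
one; it contains neither D nor v, so the fraction is a root of F in κ(q), and g ∉ q. This gives
(P1).

For the Poonen property, reduce to a finite type algebra B containing A. A closed point of the
generic fibre has residue field L finite over K, and some Frobenius power sends the image of B into
K[θ]. A root in κ(p) of a multiple of the minimal polynomial of θ specializes this to B → κ(p), a
Frobenius power on A. The resulting point of Spec B therefore has purely inseparable residue
extension (`exists_ringHom_frobenius_of_algHom`). -/

/-- Two ring homomorphisms `P → L` and `P → k` with `ker (P → L) ≤ ker (P → k)` allow one to
transport a homomorphism to `L` with image in that of `P` to a homomorphism to `k`. -/
lemma exists_ringHom_of_ker_le {P L k B : Type*} [CommRing P] [CommRing L] [CommRing k]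
    [CommRing B] (eL : P →+* L) (ek : P →+* k) (hker : RingHom.ker eL ≤ RingHom.ker ek)
    (v : B →+* L) (hv : ∀ b, v b ∈ eL.range) :
    ∃ ψ : B →+* k, ∀ b y, eL y = v b → ψ b = ek y := by
  have hs := eL.rangeRestrict_surjective
  have hker' : RingHom.ker eL.rangeRestrict ≤ RingHom.ker ek := by
    rwa [RingHom.ker_rangeRestrict]
  refine ⟨((eL.rangeRestrict).liftOfSurjective hs ⟨ek, hker'⟩).comp (v.codRestrict eL.range hv),
    fun b y h ↦ ?_⟩
  have : v.codRestrict eL.range hv b = eL.rangeRestrict y := Subtype.ext h.symm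
  rw [RingHom.comp_apply, this]
  exact RingHom.liftOfRightInverse_comp_apply _ _ _ ⟨ek, hker'⟩ y

/-- A field homomorphism whose image contains all `p ^ n`-th powers, where `p` is `1` or a prime
number vanishing in the source, is purely inseparable. -/
lemma RingHom.isPurelyInseparable_of_pow_mem {F E : Type*} [Field F] [Field E] (f : F →+* E)
    (p n : ℕ) (hp : p = 1 ∨ p.Prime ∧ (p : F) = 0) (h : ∀ z : E, z ^ p ^ n ∈ f.range) :
    f.IsPurelyInseparable := by
  algebraize [f]
  rcases hp with rfl | ⟨hp, h0⟩
  · obtain ⟨q, hq⟩ := ExpChar.exists F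
    exact (isPurelyInseparable_iff_pow_mem F q).2 fun z ↦ ⟨0, by simpa [RingHom.algebraMap_toAlgebra] using h z⟩
  · have : CharP F p := (CharP.charP_iff_prime_eq_zero hp).2 h0
    have : ExpChar F p := ExpChar.prime hp
    exact (isPurelyInseparable_iff_pow_mem F p).2 fun z ↦ ⟨n, h z⟩

/-! ### Specializing θ to a root in a residue field -/

section Specialization

variable {A : Type*} [CommRing A]

open IsLocalRing in
/-- A polynomial over the local ring of `A` at a prime `p` vanishing at `θ` also vanishes at a root
in `κ(p)` of a polynomial with leading coefficient outside `p` that is proportional to the minimal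
polynomial of `θ`. -/
lemma ker_eval_le_ker_eval {K L : Type*} [Field K] [Algebra A K] [IsFractionRing A K]
    [Field L] [Algebra K L] {θ : L} {F : A[X]} {d : K}
    (hF : F.map (algebraMap A K) = C d * minpoly K θ) (hθ : IsIntegral K θ)
    (p : Ideal A) [p.IsPrime] (hlc : F.leadingCoeff ∉ p)
    {t : p.ResidueField} (ht : F.eval₂ (algebraMap A p.ResidueField) t = 0)
    (j : Localization.AtPrime p →+* K) (hj : j.comp (algebraMap A _) = algebraMap A K) :
    RingHom.ker (eval₂RingHom ((algebraMap K L).comp j) θ) ≤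
      RingHom.ker (eval₂RingHom (residue (Localization.AtPrime p)) t) := by
  have hjinj : Function.Injective j := by
    rw [injective_iff_map_eq_zero]
    intro x hx
    obtain ⟨⟨a, s⟩, hs⟩ := IsLocalization.surj p.primeCompl x
    have h1 : algebraMap A K a = 0 := by
      rw [← hj, RingHom.comp_apply, ← hs, map_mul, hx, zero_mul]
    have h2 : a = 0 := (map_eq_zero_iff _ (IsFractionRing.injective A K)).1 h1
    simp only [h2, map_zero] at hs
    exact (IsLocalization.map_units _ s).mul_left_eq_zero.1 hs
  have hu : IsUnit (algebraMap A (Localization.AtPrime p) F.leadingCoeff) :=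
    IsLocalization.map_units _ (⟨F.leadingCoeff, hlc⟩ : p.primeCompl)
  have hdlc : algebraMap A K F.leadingCoeff = d := by
    have := congrArg leadingCoeff hF
    rwa [leadingCoeff_map_of_injective (IsFractionRing.injective A K), leadingCoeff_mul,
      leadingCoeff_C, (minpoly.monic hθ).leadingCoeff, mul_one] at this
  obtain ⟨c, hc⟩ := hu.exists_left_inv
  set G : (Localization.AtPrime p)[X] := C c * F.map (algebraMap A _) with hG
  have hGmap : G.map j = minpoly K θ := by
    have hcd : j c * d = 1 := by
      rw [← hdlc, ← hj, RingHom.comp_apply, ← map_mul, hc, map_one]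
    rw [hG, Polynomial.map_mul, map_map, hj, hF, map_C, ← mul_assoc, ← C_mul, hcd, C_1, one_mul]
  have hGmonic : G.Monic := by
    refine monic_of_injective hjinj ?_
    rw [hGmap]
    exact minpoly.monic hθ
  intro y hy
  -- As `G` is monic, divisibility by it can be tested over `K`, where it is the minimal polynomial.
  have hdvd : G ∣ y := by
    rw [← Polynomial.map_dvd_map j hjinj hGmonic, hGmap]
    refine minpoly.dvd _ _ ?_
    rw [aeval_def, eval₂_map]
    exact hy
  obtain ⟨z, rfl⟩ := hdvd
  have hG0 : G.eval₂ (residue (Localization.AtPrime p)) t = 0 := by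
    rw [hG, eval₂_mul, eval₂_map]
    erw [ht]
    rw [mul_zero]
  rw [RingHom.mem_ker, coe_eval₂RingHom, eval₂_mul, hG0, zero_mul]

end Specialization

/-! ### Irreducible components and minimal primes -/

/-- The zero locus of a minimal prime over `I` is the image of an irreducible component of
`Spec (A / I)`. -/
lemma exists_mem_irreducibleComponents_image_comap_mk {A : Type*} [CommRing A] {I q : Ideal A}
    (hq : q ∈ I.minimalPrimes) :
    ∃ T ∈ irreducibleComponents (PrimeSpectrum (A ⧸ I)),
      PrimeSpectrum.comap (Ideal.Quotient.mk I) '' T = PrimeSpectrum.zeroLocus q := by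
  rw [Ideal.minimalPrimes_eq_comap] at hq
  obtain ⟨q, hq, rfl⟩ := hq
  refine ⟨PrimeSpectrum.zeroLocus q, ?_, ?_⟩
  · rw [← PrimeSpectrum.zeroLocus_minimalPrimes]
    exact ⟨q, hq, rfl⟩
  · exact image_comap_zeroLocus_eq_zeroLocus_comap _ _
      Ideal.Quotient.mk_surjective _

/-- The hypotheses on the components of `Spec (A / xA)` in terms of minimal primes. -/
lemma HasFinitelyManyComponentsOfCodimOne.minimalPrimes {A : Type*} [CommRing A] {x : A}
    (h : HasFinitelyManyComponentsOfCodimOne A x) :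
    (Ideal.span {x}).minimalPrimes.Finite ∧
      ∀ q ∈ (Ideal.span {x}).minimalPrimes, q.height = 1 := by
  refine ⟨?_, fun q hq ↦ ?_⟩
  · refine (h.1.image fun T ↦ PrimeSpectrum.vanishingIdeal
      (PrimeSpectrum.comap (Ideal.Quotient.mk (Ideal.span {x})) '' T)).subset fun q hq ↦ ?_
    obtain ⟨T, hT, hZ⟩ := exists_mem_irreducibleComponents_image_comap_mk hq
    refine ⟨T, hT, ?_⟩
    dsimp only
    rw [hZ, PrimeSpectrum.vanishingIdeal_zeroLocus_eq_radical, hq.1.1.radical]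
  · have := hq.1.1
    obtain ⟨T, hT, hZ⟩ := exists_mem_irreducibleComponents_image_comap_mk hq
    obtain ⟨Z, hZT, hZ1⟩ := h.2 _ hT
    rw [hZ] at hZT
    have hZq : Z = OrderDual.ofDual
        (PrimeSpectrum.pointsEquivIrreducibleCloseds A ⟨q, this⟩) := by
      refine SetLike.coe_injective (hZT.trans ?_)
      change _ = closure {_}
      rw [PrimeSpectrum.closure_singleton]
    -- Primes and irreducible closed sets correspond with order reversed, so height becomes
    -- coheight.
    have h1 := PrimeSpectrum.height_eq_orderHeight (⟨q, this⟩ : PrimeSpectrum A)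
    rw [← Order.height_orderIso (PrimeSpectrum.pointsEquivIrreducibleCloseds A)] at h1
    rw [h1, ← hZ1, hZq]
    rfl

/-! ### Roots at height-one primes -/

section

variable {A : Type*} [CommRing A] [IsDomain A]

/-- Homogenizing turns vanishing at a fraction in a residue field into membership of an element of
`A` in the prime. -/
lemma Polynomial.eval₂_div_mul_pow {A k : Type*} [CommRing A] [Field k] (φ : A →+* k) (P : A[X])
    (e : A) {v : A} (hv : φ v ≠ 0) :
    P.eval₂ φ (φ e / φ v) * φ v ^ P.natDegree =
      φ (∑ i ∈ Finset.range (P.natDegree + 1), P.coeff i * e ^ i * v ^ (P.natDegree - i)) := by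
  rw [eval₂_eq_sum_range, Finset.sum_mul, map_sum]
  refine Finset.sum_congr rfl fun i hi ↦ ?_
  have hi' : i ≤ P.natDegree := Nat.lt_succ_iff.1 (Finset.mem_range.1 hi)
  rw [map_mul, map_mul, map_pow, map_pow, ← pow_sub_mul_pow (φ v) hi', div_pow]
  field_simp

/-- Under the hypotheses on the minimal primes over principal ideals, every
nonconstant polynomial has a root in the residue field of some prime outside a given proper closed
subset. -/
lemma exists_prime_exists_root [IsLocalRing A] (hdim : 2 ≤ ringKrullDim A)
    (hA : ∀ x ∈ IsLocalRing.maximalIdeal A, x ≠ 0 → (Ideal.span {x}).minimalPrimes.Finite ∧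
      ∀ q ∈ (Ideal.span {x}).minimalPrimes, q.height = 1)
    {F : A[X]} (hF : 0 < F.natDegree) {g : A} (hg : g ≠ 0) :
    ∃ (p : Ideal A) (_ : p.IsPrime), g ∉ p ∧
      ∃ t : p.ResidueField, F.eval₂ (algebraMap A p.ResidueField) t = 0 := by
  by_cases ha0 : F.coeff 0 = 0
  · exact ⟨⊥, Ideal.isPrime_bot, by simpa using hg, 0, by simp [eval₂_at_zero, ha0]⟩
  have hmax : (2 : ℕ∞) ≤ (IsLocalRing.maximalIdeal A).height := by
    rw [← IsLocalRing.maximalIdeal_height_eq_ringKrullDim] at hdim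
    exact WithBot.coe_le_coe.1 hdim
  obtain ⟨b, hb, hb0⟩ : ∃ b ∈ IsLocalRing.maximalIdeal A, b ≠ 0 := by
    by_contra! hcon
    have : IsLocalRing.maximalIdeal A = ⊥ := (Submodule.eq_bot_iff _).2 hcon
    rw [this, Ideal.height_bot] at hmax
    simp at hmax
  have hF0 : F ≠ 0 := by rintro rfl; simp at hF
  set a := F.leadingCoeff with ha
  have ha' : a ≠ 0 := leadingCoeff_ne_zero.2 hF0
  -- The factor `b` only serves to put `D` in the maximal ideal; avoiding `D` avoids the other three
  -- factors at once.
  set D := F.coeff 0 * a * g * b with hD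
  have hD0 : D ≠ 0 := by simp [hD, ha0, ha', hg, hb0]
  have hDm : D ∈ IsLocalRing.maximalIdeal A := Ideal.mul_mem_left _ _ hb
  obtain ⟨hfin, hht⟩ := hA D hDm hD0
  obtain ⟨v, hvm, hv⟩ : ∃ v ∈ IsLocalRing.maximalIdeal A,
      ∀ q ∈ (Ideal.span {D}).minimalPrimes, v ∉ q := by
    by_contra! hcon
    obtain ⟨q, hq, hle⟩ := (Ideal.subset_union_prime_finite hfin (f := id) ⊥ ⊥
      (fun q hq _ _ ↦ hq.1.1) (I := IsLocalRing.maximalIdeal A)).1 (by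
        intro v hv
        obtain ⟨q, hq, hvq⟩ := hcon v hv
        exact Set.mem_biUnion hq hvq)
    have := (hmax.trans (Ideal.height_mono hle)).trans_eq (hht q hq)
    simp at this
  set F₁ := F.divX with hF₁
  have hdeg : F₁.natDegree + 1 = F.natDegree := by
    rw [hF₁, natDegree_divX_eq_natDegree_tsub_one]; omega
  have hlc : F₁.coeff F₁.natDegree = a := by
    rw [ha, leadingCoeff, ← hdeg, hF₁, coeff_divX]
  set e := F.coeff 0 * D with he
  set N := ∑ i ∈ Finset.range (F₁.natDegree + 1), F₁.coeff i * e ^ i * v ^ (F₁.natDegree - i)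
    with hN
  set w := v ^ F.natDegree + D * N with hw
  have hvD : ∀ q : Ideal A, q.IsPrime → D ∈ q → w ∈ q → v ∈ q := fun q hq h1 h2 ↦
    hq.mem_of_pow_mem _ ((Ideal.add_mem_iff_left _ (Ideal.mul_mem_right _ _ h1)).1 h2)
  -- Modulo `v` only the top term `a * e ^ F₁.natDegree` of `N` survives, and its prime factors
  -- would force `D ∈ q`.
  have hmem (q : Ideal A) (hq : q.IsPrime) (hDq : D ∉ q) (hwq : w ∈ q) : v ∉ q := by
    intro hvq
    have h1 : N ∈ q := by
      refine (hq.mem_or_mem ((Ideal.add_mem_iff_right _ ?_).1 hwq)).resolve_left hDq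
      exact Ideal.pow_mem_of_mem _ hvq _ hF
    rw [hN, Finset.sum_range_succ, hlc, Nat.sub_self, pow_zero, mul_one,
      Ideal.add_mem_iff_right] at h1
    · rcases hq.mem_or_mem h1 with h | h
      · exact hDq (by rw [hD]; exact Ideal.mul_mem_right _ _ (Ideal.mul_mem_right _ _
          (Ideal.mul_mem_left _ _ h)))
      · rcases hq.mem_or_mem (hq.mem_of_pow_mem _ h) with h | h
        · exact hDq (by rw [hD]; exact Ideal.mul_mem_right _ _ (Ideal.mul_mem_right _ _
            (Ideal.mul_mem_right _ _ h)))
        · exact hDq h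
    · refine Ideal.sum_mem _ fun i hi ↦ Ideal.mul_mem_left _ _ (Ideal.pow_mem_of_mem _ hvq _ ?_)
      have := Finset.mem_range.1 hi
      omega
  have hwm : w ∈ IsLocalRing.maximalIdeal A :=
    Ideal.add_mem _ (Ideal.pow_mem_of_mem _ hvm _ hF) (Ideal.mul_mem_right _ _ hDm)
  have hne (x : A) (hx : x ∈ IsLocalRing.maximalIdeal A) : Ideal.span {x} ≠ ⊤ := by
    rw [Ne, Ideal.span_singleton_eq_top]
    exact hx
  have hw0 : w ≠ 0 := by
    intro hw0
    obtain ⟨q, hq⟩ := Ideal.nonempty_minimalPrimes (hne D hDm)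
    exact hv q hq (hvD q hq.1.1 (hq.1.2 (Ideal.mem_span_singleton_self D)) (by simp [hw0]))
  obtain ⟨q, hq⟩ := Ideal.nonempty_minimalPrimes (hne w hwm)
  have hqp : q.IsPrime := hq.1.1
  have hwq : w ∈ q := hq.1.2 (Ideal.mem_span_singleton_self w)
  have hDq : D ∉ q := by
    -- A minimal prime over `D` inside `q` also has height one, hence equals `q`; but then `v ∈ q`.
    intro hDq
    obtain ⟨q', hq', hle⟩ := Ideal.exists_minimalPrimes_le
      ((Ideal.span_singleton_le_iff_mem q).2 hDq)
    have hq'p : q'.IsPrime := hq'.1.1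
    have heq : q' = q := by
      by_contra hcon
      have hlt : q' < q := lt_of_le_of_ne hle hcon
      have := Ideal.height_add_one_le_of_lt_of_isPrime hlt
      rw [hht q' hq', (hA w hwm hw0).2 q hq] at this
      norm_num at this
    subst heq
    exact hv q' hq' (hvD q' hqp hDq hwq)
  refine ⟨q, hqp, fun h ↦ hDq (Ideal.mul_mem_right _ _ (Ideal.mul_mem_left _ _ h)), ?_⟩
  have hφv : algebraMap A q.ResidueField v ≠ 0 := by
    rw [Ne, Ideal.algebraMap_residueField_eq_zero]
    exact hmem q hqp hDq hwq
  refine ⟨algebraMap A _ e / algebraMap A _ v, ?_⟩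
  refine (mul_eq_zero_iff_right (pow_ne_zero F.natDegree hφv)).1 ?_
  have key := eval₂_div_mul_pow (algebraMap A q.ResidueField) F₁ e hφv
  rw [← hN] at key
  have hdecomp : F = F₁ * X + C (F.coeff 0) := (divX_mul_X_add F).symm
  have hwz : algebraMap A q.ResidueField w = 0 := Ideal.algebraMap_residueField_eq_zero.2 hwq
  calc F.eval₂ (algebraMap A q.ResidueField) (algebraMap A _ e / algebraMap A _ v) *
        algebraMap A _ v ^ F.natDegree
      = (F₁.eval₂ (algebraMap A q.ResidueField) (algebraMap A _ e / algebraMap A _ v) *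
          algebraMap A _ v ^ F₁.natDegree) * algebraMap A _ e +
          algebraMap A _ (F.coeff 0) * algebraMap A _ v ^ F.natDegree := by
        conv_lhs => enter [1]; rw [hdecomp]
        rw [eval₂_add, eval₂_mul, eval₂_X, eval₂_C, ← hdeg, pow_succ]
        generalize F₁.eval₂ (algebraMap A q.ResidueField) _ = c
        field_simp
    _ = algebraMap A _ (F.coeff 0) * algebraMap A _ w := by
        rw [key, hw, he]
        simp only [map_mul, map_add, map_pow]
        ring
    _ = 0 := by rw [hwz, mul_zero]

end

/-! ### Specializing finite type algebras up to Frobenius -/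

section

variable {A : Type*} [CommRing A] [IsDomain A]

/-- A polynomial over the fraction field becomes integral after multiplication by a nonzero
element. -/
lemma exists_map_eq_C_mul {K : Type*} [Field K] [Algebra A K] [IsFractionRing A K] (P : K[X]) :
    ∃ c : A, c ≠ 0 ∧ ∃ Q : A[X], Q.map (algebraMap A K) = C (algebraMap A K c) * P := by
  obtain ⟨c, hc, h⟩ := IsLocalization.integerNormalization_spec (nonZeroDivisors A) P
  refine ⟨c, nonZeroDivisors.ne_zero hc, _, h.trans ?_⟩
  rw [← algebraMap_smul K, smul_eq_C_mul]

/-- Over a finite field extension `L / K`, some power of the exponential characteristic maps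
finitely many given elements into a simple separable subextension. -/
lemma exists_forall_pow_mem_adjoin_singleton {K L : Type*} [Field K] [Field L] [Algebra K L]
    [FiniteDimensional K L] (p : ℕ) [ExpChar K p] (s : Finset L) :
    ∃ θ : L, ∃ n : ℕ, ∀ x ∈ s, x ^ p ^ n ∈ Algebra.adjoin K {θ} := by
  have := separableClosure.isPurelyInseparable K L
  obtain ⟨θ, hθ⟩ := Field.exists_primitive_element K (separableClosure K L)
  have : ExpChar (separableClosure K L) p :=
    expChar_of_injective_algebraMap (algebraMap K (separableClosure K L)).injective p
  have hmem (y : separableClosure K L) : (y : L) ∈ Algebra.adjoin K {(θ : L)} := by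
    have h1 : y ∈ Algebra.adjoin K {θ} := by
      rw [← IntermediateField.adjoin_simple_toSubalgebra_of_isAlgebraic
        (Algebra.IsAlgebraic.isAlgebraic θ), hθ]
      trivial
    have h2 : (separableClosure K L).val y ∈
        (Algebra.adjoin K {θ}).map (separableClosure K L).val := Subalgebra.mem_map.2 ⟨y, h1, rfl⟩
    rwa [AlgHom.map_adjoin, Set.image_singleton] at h2
  choose n hn using fun x : L ↦ IsPurelyInseparable.pow_mem (separableClosure K L) p x
  -- The supremum gives one exponent for all elements of `s`.
  refine ⟨θ, s.sup n, fun x hx ↦ ?_⟩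
  obtain ⟨y, hy⟩ := hn x
  have : x ^ p ^ s.sup n = ((y ^ p ^ (s.sup n - n x) : separableClosure K L) : L) := by
    rw [← Nat.add_sub_cancel' (Finset.le_sup (f := n) hx), pow_add, pow_mul, ← hy]
    simp
  rw [this]
  exact hmem _

/-- Assume that every nonconstant polynomial over `A` has roots in residue fields of primes outside
any proper closed subset. Then a finite type `A`-algebra with a point in a finite extension of the
fraction field of `A` has a homomorphism to a residue field of `A` lying over a power of the
Frobenius. -/
lemma exists_ringHom_frobenius_of_algHom
    (H : ∀ F : A[X], 0 < F.natDegree → ∀ g : A, g ≠ 0 → ∃ (p : Ideal A) (_ : p.IsPrime), g ∉ p ∧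
      ∃ t : p.ResidueField, F.eval₂ (algebraMap A p.ResidueField) t = 0)
    (K : Type*) {L B : Type*} [Field K] [Algebra A K] [IsFractionRing A K] [Field L] [Algebra K L]
    [Algebra A L] [IsScalarTower A K L] [FiniteDimensional K L]
    [CommRing B] [Algebra A B] [Algebra.FiniteType A B] (u : B →ₐ[A] L) :
    ∃ (p : Ideal A) (_ : p.IsPrime) (ψ : B →+* p.ResidueField) (l n : ℕ),
      (l = 1 ∨ l.Prime ∧ (l : p.ResidueField) = 0) ∧
      ∀ a, ψ (algebraMap A B a) = algebraMap A p.ResidueField a ^ l ^ n := by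
  classical
  obtain ⟨l, hl⟩ := ExpChar.exists K
  have : ExpChar L l := expChar_of_injective_algebraMap (algebraMap K L).injective l
  obtain ⟨s, hs⟩ := Algebra.FiniteType.out (R := A) (A := B)
  obtain ⟨θ, n, hθ⟩ := exists_forall_pow_mem_adjoin_singleton (K := K) l (s.image u)
  have hint : IsIntegral K θ := Algebra.IsIntegral.isIntegral θ
  obtain ⟨d, hd, F, hF⟩ := exists_map_eq_C_mul (A := A) (minpoly K θ)
  have hP (x : L) (hx : x ∈ s.image u) : ∃ (c : A) (Q : A[X]), c ≠ 0 ∧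
      aeval θ (Q.map (algebraMap A K)) = algebraMap K L (algebraMap A K c) * x ^ l ^ n := by
    have := hθ x hx
    rw [Algebra.adjoin_singleton_eq_range_aeval] at this
    obtain ⟨P, hP⟩ := this
    obtain ⟨c, hc, Q, hQ⟩ := exists_map_eq_C_mul (A := A) P
    refine ⟨c, Q, hc, ?_⟩
    rw [hQ, map_mul, aeval_C, ← hP]
    rfl
  choose! c Q hc hQ using hP
  have hKinj : Function.Injective (algebraMap A K) := IsFractionRing.injective A K
  have hdK : algebraMap A K d ≠ 0 := by simpa using hd
  have hdeg : 0 < F.natDegree := by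
    rw [← natDegree_map_eq_of_injective hKinj, hF, natDegree_C_mul hdK]
    exact minpoly.natDegree_pos hint
  have hF0 : F ≠ 0 := by rintro rfl; simp at hdeg
  -- Avoiding this product makes the leading coefficient and all denominators `c x` units in the
  -- local ring at `p`.
  obtain ⟨p, hp, hgp, t, ht⟩ := H F hdeg (F.leadingCoeff * ∏ x ∈ s.image u, c x)
    (mul_ne_zero (leadingCoeff_ne_zero.2 hF0) (Finset.prod_ne_zero_iff.2 hc))
  have hlc : F.leadingCoeff ∉ p := fun h ↦ hgp (Ideal.mul_mem_right _ _ h)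
  have hcp (x : L) (hx : x ∈ s.image u) : c x ∉ p := fun h ↦
    hgp (Ideal.mul_mem_left _ _ (Ideal.mem_of_dvd _ (Finset.dvd_prod_of_mem c hx) h))
  let j : Localization.AtPrime p →+* K := IsLocalization.lift (M := p.primeCompl)
    (g := algebraMap A K) fun y ↦ IsUnit.mk0 _ fun h ↦ y.2 (by
      rw [(map_eq_zero_iff _ hKinj).1 h]; exact p.zero_mem)
  have hj : j.comp (algebraMap A _) = algebraMap A K := IsLocalization.lift_comp _
  have hker := ker_eval_le_ker_eval hF hint p hlc ht j hj
  set eL : (Localization.AtPrime p)[X] →+* L := eval₂RingHom ((algebraMap K L).comp j) θ with heL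
  have heLA (P : A[X]) :
      eL (P.map (algebraMap A _)) = aeval θ (P.map (algebraMap A K)) := by
    rw [heL, coe_eval₂RingHom, eval₂_map, RingHom.comp_assoc, hj, aeval_def, eval₂_map]
  have hv (b : B) : ((iterateFrobenius L l n).comp u.toRingHom) b ∈ eL.range := by
    have hb : b ∈ Algebra.adjoin A (s : Set B) := hs ▸ Algebra.mem_top
    induction hb using Algebra.adjoin_induction with
    | mem x hx =>
      have hx' : u x ∈ s.image u := Finset.mem_image_of_mem u hx
      obtain ⟨w, hw⟩ := (IsLocalization.map_units (Localization.AtPrime p)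
        (⟨c (u x), hcp _ hx'⟩ : p.primeCompl)).exists_left_inv
      refine ⟨C w * (Q (u x)).map (algebraMap A _), ?_⟩
      rw [map_mul, heLA, hQ _ hx', ← mul_assoc]
      have : eL (C w) * algebraMap K L (algebraMap A K (c (u x))) = 1 := by
        have h1 : eL (C (algebraMap A _ (c (u x)))) = algebraMap K L (algebraMap A K (c (u x))) := by
          rw [← map_C, heLA, map_C, aeval_C]
        rw [← h1, ← map_mul, ← C_mul, hw, C_1, map_one]
      rw [this, one_mul]
      rfl
    | algebraMap a =>
      refine ⟨(C (a ^ l ^ n)).map (algebraMap A _), ?_⟩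
      rw [heLA]
      simp [iterateFrobenius_def, IsScalarTower.algebraMap_apply A K L]
    | add x y _ _ hx hy => rw [map_add]; exact add_mem hx hy
    | mul x y _ _ hx hy => rw [map_mul]; exact mul_mem hx hy
  obtain ⟨ψ, hψ⟩ := exists_ringHom_of_ker_le eL _ hker _ hv
  refine ⟨p, hp, ψ, l, n, ?_, fun a ↦ ?_⟩
  · rcases hl with _ | hl
    · exact Or.inl rfl
    · refine Or.inr ⟨hl, ?_⟩
      have : (l : A) = 0 := hKinj (by simp)
      rw [← map_natCast (algebraMap A p.ResidueField), this, map_zero]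
  · rw [hψ _ ((C (a ^ l ^ n)).map (algebraMap A _))]
    · rw [map_C, coe_eval₂RingHom, eval₂_C, map_pow, map_pow]
      rfl
    · rw [heLA]
      simp [iterateFrobenius_def, IsScalarTower.algebraMap_apply A K L]

/-- Assume that every nonconstant polynomial over `A` has roots in residue fields of primes outside
any proper closed subset. Then a finite type `A`-algebra with injective structure map has a
homomorphism to a residue field of `A` lying over a power of the Frobenius. -/
lemma exists_ringHom_frobenius
    (H : ∀ F : A[X], 0 < F.natDegree → ∀ g : A, g ≠ 0 → ∃ (p : Ideal A) (_ : p.IsPrime), g ∉ p ∧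
      ∃ t : p.ResidueField, F.eval₂ (algebraMap A p.ResidueField) t = 0)
    {B : Type*} [CommRing B] [Algebra A B] [Algebra.FiniteType A B]
    (hinj : Function.Injective (algebraMap A B)) :
    ∃ (p : Ideal A) (_ : p.IsPrime) (ψ : B →+* p.ResidueField) (l n : ℕ),
      (l = 1 ∨ l.Prime ∧ (l : p.ResidueField) = 0) ∧
      ∀ a, ψ (algebraMap A B a) = algebraMap A p.ResidueField a ^ l ^ n := by
  let K := FractionRing A
  have : Nontrivial (TensorProduct A K B) :=
    (Algebra.TensorProduct.includeLeft_injective (R := A) (S := A) (A := K) (B := B)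
      hinj).nontrivial
  obtain ⟨M, hM⟩ := Ideal.exists_maximal (TensorProduct A K B)
  let : Field (TensorProduct A K B ⧸ M) := Ideal.Quotient.field M
  have : FiniteDimensional K (TensorProduct A K B ⧸ M) :=
    finite_of_finite_type_of_isJacobsonRing K (TensorProduct A K B ⧸ M)
  exact exists_ringHom_frobenius_of_algHom H K
    ((Ideal.Quotient.mkₐ A M).comp Algebra.TensorProduct.includeRight)

end

/-! ### From ring homomorphisms to points of schemes -/

/-- If `Spec k ⟶ X ⟶ Spec A` corresponds to `φ : A → k` and every `q`-th power in `k` is a fraction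
of elements of `φ A`, then at the image point of `X` every `q`-th power in the residue field comes
from the residue field downstairs. -/
lemma pow_mem_range_residueFieldMap {A : Type u} [CommRing A] {X : Scheme.{u}}
    (h : X ⟶ Spec (CommRingCat.of A)) {k : Type u} [Field k] (i : Spec (CommRingCat.of k) ⟶ X)
    (φ : A →+* k) (hi : i ≫ h = Spec.map (CommRingCat.ofHom φ)) (q : ℕ)
    (hq : ∀ z : k, ∃ a b, z ^ q = φ a / φ b)
    (z : X.residueField (i (IsLocalRing.closedPoint k))) :
    z ^ q ∈ (h.residueFieldMap (i (IsLocalRing.closedPoint k))).hom.range := by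
  let x := i (IsLocalRing.closedPoint k)
  let τ : X.residueField x ⟶ CommRingCat.of k := X.descResidueField (Scheme.stalkClosedPointTo i)
  have hτ : Spec.map τ ≫ X.fromSpecResidueField x = i :=
    Scheme.descResidueField_stalkClosedPointTo_fromSpecResidueField k X i
  obtain ⟨α, hα⟩ : ∃ α : CommRingCat.of A ⟶ (Spec (CommRingCat.of A)).residueField (h x),
      Spec.map α = (Spec (CommRingCat.of A)).fromSpecResidueField (h x) := by
    refine ⟨_, (Spec.map_comp _ _).trans
      (Scheme.Spec.map_residueFieldIso_inv_eq_fromSpecResidueField (CommRingCat.of A) (h x))⟩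
  have hcomp : α ≫ h.residueFieldMap x ≫ τ = CommRingCat.ofHom φ := by
    rw [← Spec.map_inj, Spec.map_comp, Spec.map_comp, hα, Category.assoc,
      Scheme.Hom.SpecMap_residueFieldMap_fromSpecResidueField, ← Category.assoc, hτ, hi]
  have hcomp' (a : A) : τ.hom ((h.residueFieldMap x).hom (α.hom a)) = φ a :=
    congrArg (fun f ↦ f.hom a) hcomp
  obtain ⟨a, b, hab⟩ := hq (τ.hom z)
  -- The equality is checked in `k`, into which the residue field embeds by `τ`.
  refine ⟨α.hom a / α.hom b, τ.hom.injective ?_⟩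
  rw [map_div₀, map_div₀, map_pow, hcomp', hcomp']
  exact hab.symm

lemma Ideal.ResidueField.exists_eq_div {A : Type*} [CommRing A] (p : Ideal A) [p.IsPrime]
    (z : p.ResidueField) :
    ∃ a b, z = algebraMap A p.ResidueField a / algebraMap A p.ResidueField b := by
  obtain ⟨a, b, -, rfl⟩ := IsFractionRing.div_surjective (A := A ⧸ p) z
  obtain ⟨a, rfl⟩ := Ideal.Quotient.mk_surjective a
  obtain ⟨b, rfl⟩ := Ideal.Quotient.mk_surjective b
  exact ⟨a, b, rfl⟩

/-- Condition (P1) follows from the existence of roots in residue fields at primes outside any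
proper closed subset. -/
lemma conditionP1_of_exists_root {A : Type u} [CommRing A]
    (H : ∀ F : A[X], 0 < F.natDegree → ∀ g : A, g ≠ 0 → ∃ (p : Ideal A) (_ : p.IsPrime), g ∉ p ∧
      ∃ t : p.ResidueField, F.eval₂ (algebraMap A p.ResidueField) t = 0) :
    ConditionP1 A := by
  intro F hF
  refine PrimeSpectrum.isTopologicalBasis_basic_opens.dense_iff.2 ?_
  rintro _ ⟨g, rfl⟩ ⟨y, hy⟩
  have hg : g ≠ 0 := by
    rintro rfl
    exact hy y.asIdeal.zero_mem
  obtain ⟨p, hp, hgp, t, ht⟩ := H F hF g hg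
  let ψ : A[X] ⧸ Ideal.span {F} →+* p.ResidueField :=
    Ideal.Quotient.lift (Ideal.span {F}) (eval₂RingHom (algebraMap A p.ResidueField) t) (by
      intro a ha
      obtain ⟨b, rfl⟩ := Ideal.mem_span_singleton.1 ha
      rw [map_mul, coe_eval₂RingHom, ht, zero_mul])
  let i : Spec (CommRingCat.of p.ResidueField) ⟶ Spec (CommRingCat.of (A[X] ⧸ Ideal.span {F})) :=
    Spec.map (CommRingCat.ofHom ψ)
  have hψ : ψ.comp (algebraMap A _) = algebraMap A p.ResidueField := by
    ext a
    change ψ (Ideal.Quotient.mk _ (C a)) = _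
    simp [ψ]
  have hi : i ≫ hypersurfaceHom A F =
      Spec.map (CommRingCat.ofHom (algebraMap A p.ResidueField)) := by
    rw [hypersurfaceHom, ← Spec.map_comp, ← CommRingCat.ofHom_comp, hψ]
  refine ⟨hypersurfaceHom A F (i (IsLocalRing.closedPoint p.ResidueField)), ?_, _, ?_, rfl⟩
  · have h1 : hypersurfaceHom A F (i (IsLocalRing.closedPoint p.ResidueField)) =
        (Spec.map (CommRingCat.ofHom (algebraMap A p.ResidueField)))
          (IsLocalRing.closedPoint p.ResidueField) := by
      rw [← hi]; rfl
    rw [h1]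
    change algebraMap A p.ResidueField g ∉ IsLocalRing.maximalIdeal p.ResidueField
    rw [IsLocalRing.maximalIdeal_eq_bot, Ideal.mem_bot, Ideal.algebraMap_residueField_eq_zero]
    exact hgp
  · refine ⟨RingHom.injective _, fun z ↦ ?_⟩
    have := pow_mem_range_residueFieldMap (hypersurfaceHom A F) i _ hi 1 (fun z ↦ by
      simpa using Ideal.ResidueField.exists_eq_div p z) z
    rwa [pow_one] at this

/-- A dominant quasi-compact morphism to a nonempty open subscheme of the spectrum of a domain `A`
restricts to some affine open `V` with `A → Γ(X, V)` injective. -/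
lemma exists_isAffineOpen_specMap_injective {A : Type u} [CommRing A] [IsDomain A]
    (U : (Spec (CommRingCat.of A)).Opens) (hU : (U : Set (Spec (CommRingCat.of A))).Nonempty)
    {X : Scheme.{u}} (f : X ⟶ U) [QuasiCompact f] [IsDominant f] :
    ∃ (V : X.Opens) (hV : IsAffineOpen V) (φ : CommRingCat.of A ⟶ Γ(X, V)),
      hV.fromSpec ≫ f ≫ U.ι = Spec.map φ ∧ Function.Injective φ.hom := by
  obtain ⟨y, hy⟩ := hU
  let η : Spec (CommRingCat.of A) := (⟨⊥, Ideal.isPrime_bot⟩ : PrimeSpectrum A)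
  have hη : η ∈ U := by
    refine Specializes.mem_open (x := η) (y := y) ?_ U.isOpen hy
    exact (PrimeSpectrum.le_iff_specializes (⟨⊥, Ideal.isPrime_bot⟩ : PrimeSpectrum A) y).1 bot_le
  obtain ⟨ηU, hηU⟩ : ∃ ηU : (U : Scheme.{u}), U.ι ηU = η := ⟨⟨η, hη⟩, rfl⟩
  obtain ⟨W, hW, hηW, -⟩ := exists_isAffineOpen_mem_and_subset (Opens.mem_top ηU)
  obtain ⟨s, hs, hs'⟩ := isCompact_iff_finite_and_eq_biUnion_affineOpens.1
    (f.isCompact_preimage hW.isCompact)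
  -- Since the cover is finite, closure commutes with the union, so a single affine piece already
  -- has the generic point in the closure of its image.
  have hcl : ηU ∈ closure (⋃ V ∈ s, f '' (V.1 : Set X)) := by
    rw [mem_closure_iff]
    intro O hO hηO
    obtain ⟨_, ⟨hz1, hz2⟩, z, rfl⟩ := f.denseRange.inter_open_nonempty (O ∩ W)
      (hO.inter W.isOpen) ⟨_, hηO, hηW⟩
    have hz : z ∈ f ⁻¹ᵁ W := hz2
    rw [hs'] at hz
    simp only [Opens.mem_iSup] at hz
    obtain ⟨V, hV, hz⟩ := hz
    exact ⟨f z, hz1, Set.mem_biUnion hV ⟨z, hz, rfl⟩⟩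
  rw [hs.closure_biUnion] at hcl
  simp only [Set.mem_iUnion] at hcl
  obtain ⟨V, -, hV⟩ := hcl
  obtain ⟨φ, hφ⟩ : ∃ φ : CommRingCat.of A ⟶ Γ(X, V), V.2.fromSpec ≫ f ≫ U.ι = Spec.map φ :=
    ⟨Spec.preimage _, (Spec.map_preimage _).symm⟩
  refine ⟨V, V.2, φ, hφ, ?_⟩
  have h1 : η ∈ closure (U.ι '' (f '' (V.1 : Set X))) :=
    image_closure_subset_closure_image U.ι.continuous ⟨_, hV, hηU⟩
  have h2 : U.ι '' (f '' (V.1 : Set X)) = Set.range (PrimeSpectrum.comap φ.hom) := by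
    have h3 : Set.range (V.2.fromSpec ≫ f ≫ U.ι) = Set.range (Spec.map φ) := by rw [hφ]
    rw [← V.2.range_fromSpec, ← Set.range_comp, ← Set.range_comp]
    exact h3
  have h4 : η ∈ PrimeSpectrum.zeroLocus (RingHom.ker φ.hom : Set A) := by
    have := PrimeSpectrum.closure_range_comap φ.hom
    rw [← h2] at this
    exact this ▸ h1
  exact (RingHom.injective_iff_ker_eq_bot _).2 (le_bot_iff.1 h4)

/-- A domain over which nonconstant polynomials have roots in residue fields at primes outside any
proper closed subset is a Poonen ring. -/
lemma isPoonenRing_of_exists_root {A : Type u} [CommRing A] [IsDomain A]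
    (H : ∀ F : A[X], 0 < F.natDegree → ∀ g : A, g ≠ 0 → ∃ (p : Ideal A) (_ : p.IsPrime), g ∉ p ∧
      ∃ t : p.ResidueField, F.eval₂ (algebraMap A p.ResidueField) t = 0) :
    IsPoonenRing A := by
  intro U hU X f hfp hqc _ hdom
  obtain ⟨V, hV, φ, hφ, hinj⟩ := exists_isAffineOpen_specMap_injective U hU f
  have : LocallyOfFiniteType f := inferInstance
  have hft : LocallyOfFiniteType (Spec.map φ) := by rw [← hφ]; infer_instance
  let : Algebra A Γ(X, V) := φ.hom.toAlgebra
  have : Algebra.FiniteType A Γ(X, V) :=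
    (HasRingHomProperty.Spec_iff (P := @LocallyOfFiniteType)).1 hft
  obtain ⟨p, hp, ψ, l, n, hl, hψ⟩ := exists_ringHom_frobenius H hinj
  let i : Spec (CommRingCat.of p.ResidueField) ⟶ X :=
    Spec.map (CommRingCat.ofHom ψ) ≫ hV.fromSpec
  have hi : i ≫ f ≫ U.ι = Spec.map (CommRingCat.ofHom (ψ.comp φ.hom)) := by
    rw [Category.assoc, hφ, ← Spec.map_comp]
    rfl
  let x := i (IsLocalRing.closedPoint p.ResidueField)
  let τ : X.residueField x ⟶ CommRingCat.of p.ResidueField :=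
    X.descResidueField (Scheme.stalkClosedPointTo i)
  refine ⟨f x, x, ?_, rfl⟩
  refine RingHom.isPurelyInseparable_of_pow_mem _ l n (hl.imp_right fun h ↦ ⟨h.1, ?_⟩) fun z ↦ ?_
  -- The characteristic is read off in `κ(p)`, which contains both residue fields.
  · refine (τ.hom.comp (f.residueFieldMap x).hom).injective ?_
    rw [map_natCast, map_zero]
    exact h.2
  · have := pow_mem_range_residueFieldMap (f ≫ U.ι) i _ hi (l ^ n) (fun z ↦ by
      obtain ⟨a, b, rfl⟩ := Ideal.ResidueField.exists_eq_div p z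
      refine ⟨a, b, ?_⟩
      rw [div_pow, ← hψ, ← hψ]
      rfl) z
    obtain ⟨y, hy⟩ := this
    rw [Scheme.residueFieldMap_comp] at hy
    exact ⟨_, hy⟩

theorem mainTheorem4 (A : Type u) [CommRing A] [IsDomain A] [IsLocalRing A]
    (hdim : 2 ≤ ringKrullDim A)
    (hA : ∀ x ∈ IsLocalRing.maximalIdeal A, x ≠ 0 → HasFinitelyManyComponentsOfCodimOne A x) :
    ConditionP1 A ∧ IsPoonenRing A := by
  have H : ∀ F : A[X], 0 < F.natDegree → ∀ g : A, g ≠ 0 →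
      ∃ (p : Ideal A) (_ : p.IsPrime), g ∉ p ∧
        ∃ t : p.ResidueField, F.eval₂ (algebraMap A p.ResidueField) t = 0 :=
    fun F hF g hg ↦ exists_prime_exists_root hdim (fun x hx hx0 ↦ (hA x hx hx0).minimalPrimes)
      hF hg
  exact ⟨conditionP1_of_exists_root H, isPoonenRing_of_exists_root H⟩
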